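/- Let $\mathcal H$ be a real Hilbert space, let $N\ge 1$, and equip $\mathcal H^N$ with the inner product $\langle \mathbf x,\mathbf z\rangle=\sum_{i=1}^N\langle x_i,z_i\rangle$. Let $V\subset\mathcal H^N$ be a closed vector subspace, let $\mathcal Q_1,\dots,\mathcal Q_N\subset\mathcal H$ be nonempty closed convex sets, and put $\overline{\mathcal Q}=\mathcal Q_1\times\cdots\times\mathcal Q_N$. Let $\mathcal P$ be a nonempty closed convex subset of the simplex $\Delta_N=\{p\in\mathbb R_+^N:\sum_{i}p_i=1\}$, let $a_i\in\mathcal H\setminus\{0\}$ and $\xi_i\in\mathbb R$ for $1\le i\le N$, let $\beta>0$, and let $H:\mathcal H^N\to\mathbb R$ be convex and differentiable with $\beta^{-1}$-Lipschitz gradient. Write $f(\mathbf x)=\sup_{p\in\mathcal P}\sum_{i=1}^N p_i(\langle a_i,x_i\rangle+\xi_i)$ and consider the problem $$\min_{\mathbf x\in V\cap\overline{\mathcal Q}}\ H(\mathbf x)+f(\mathbf x).\tag{1}$$ Assume that the optimality condition of (1) is solvable: there is $\mathbf x^*\in\mathcal H^N$ with $$0\in\partial f(\mathbf x^*)+N_{\overline{\mathcal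 Q}}(\mathbf x^*)+\nabla H(\mathbf x^*)+N_V(\mathbf x^*),$$ where $\partial f$ is the convex subdifferential and $N_C(\mathbf x)$ is the normal cone to the convex set $C$ at $\mathbf x$ (empty if $\mathbf x\notin C$). For $\alpha\in\mathbb R_{++}^N$ and $b\in\mathbb R^N$ let $\rho(\alpha,b)$ be the unique minimizer over $p\in\mathcal P$ of $\frac12\sum_i p_i^2\alpha_i-\sum_i p_ib_i$. Let $\lambda\in\,]0,2\beta[$ and let $\gamma>0$ satisfy $\gamma<\frac1\lambda-\frac1{2\beta}$. Let $\mathbf u^0\in\mathcal H^N$, $\mathbf x^0\in V$, $\overline{\mathbf x}^0=\mathbf x^0$, $\mathbf y^0\in V^\perp$, and for every $k\in\mathbb N$ define $$\begin{aligned} u_i^{k+1}&=u_i^k+\gamma\overline x_i^k-\gamma\operatorname{proj}_{\mathcal Q_i}\big(u_i^k/\gamma+\overline x_i^k\big)\quad(1\le i\le N),\\ \overline{\mathbf z}^k&=\mathbf x^k+\lambda\mathbf y^k-\lambda\operatorname{proj}_V\big(\mathbf u^{k+1}+\nabla H(\mathbf x^k)\big),\\ p^k&=\rho\big((\lambda\|a_i\|^2)_{i=1}^N,(\langle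 a_i,\overline z_i^k\rangle+\xi_i)_{i=1}^N\big),\\ w_i^{k+1}&=\overline z_i^k-\lambda p_i^ka_i\quad(1\le i\le N),\\ \mathbf x^{k+1}&=\operatorname{proj}_V\mathbf w^{k+1},\\ \mathbf y^{k+1}&=\mathbf y^k+(\mathbf x^{k+1}-\mathbf w^{k+1})/\lambda,\\ \overline{\mathbf x}^{k+1}&=2\mathbf x^{k+1}-\mathbf x^k. \end{aligned}$$ Then there exists a solution $\mathbf x\in\mathcal H^N$ of (1) such that $\mathbf x^k$ converges weakly to $\mathbf x$. -/

import Mathlib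

open Filter Topology
open scoped Gradient InnerProductSpace

namespace DRO

/-- A minimizer of `g` over `S` (an arbitrary point if there is none).  It is only used below for
problems with exactly one minimizer, see `proj_spec`, `eq_proj`, `rho_spec` and `eq_rho`. -/
noncomputable def argmin {α : Type*} [Nonempty α] (S : Set α) (g : α → ℝ) : α :=
  Classical.epsilon fun y => y ∈ S ∧ IsMinOn g S y

theorem argmin_spec {α : Type*} [Nonempty α] {S : Set α} {g : α → ℝ}
    (h : ∃ y, y ∈ S ∧ IsMinOn g S y) : argmin S g ∈ S ∧ IsMinOn g S (argmin S g) :=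
  Classical.epsilon_spec h

/-- The projection `proj_Q x = argmin_{y ∈ Q} ‖x - y‖`. -/
noncomputable def proj {E : Type*} [NormedAddCommGroup E] (Q : Set E) (x : E) : E :=
  argmin Q fun y => ‖x - y‖

/-- `ρ(α, β) = argmin_{p ∈ P} (1/2) ∑ pᵢ² αᵢ - ∑ pᵢ βᵢ`. -/
noncomputable def rho {N : ℕ} (P : Set (Fin N → ℝ)) (α β : Fin N → ℝ) : Fin N → ℝ :=
  argmin P fun p => (1 / 2) * ∑ i, p i ^ 2 * α i - ∑ i, p i * β i

/-- The Hilbert space `E ^ N`, with inner product `⟪x, y⟫ = ∑ i, ⟪xᵢ, yᵢ⟫`. -/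
abbrev Pow (E : Type*) (N : ℕ) : Type _ := PiLp 2 fun _ : Fin N => E

section Projection

variable {E : Type*} [NormedAddCommGroup E] [InnerProductSpace ℝ E] [CompleteSpace E]

theorem proj_spec {Q : Set E} (hne : Q.Nonempty) (hcl : IsClosed Q) (hcv : Convex ℝ Q) (x : E) :
    proj Q x ∈ Q ∧ IsMinOn (fun y => ‖x - y‖) Q (proj Q x) := by
  apply argmin_spec
  obtain ⟨v, hv, h⟩ := exists_norm_eq_iInf_of_complete_convex hne hcl.isComplete hcv x
  refine ⟨v, hv, fun w hw => ?_⟩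
  change ‖x - v‖ ≤ ‖x - w‖
  rw [h]
  exact ciInf_le ⟨0, Set.forall_mem_range.2 fun _ => norm_nonneg _⟩ (⟨w, hw⟩ : Q)

theorem eq_proj {Q : Set E} (hcl : IsClosed Q) (hcv : Convex ℝ Q) {x y : E} (hy : y ∈ Q)
    (hmin : IsMinOn (fun y => ‖x - y‖) Q y) : y = proj Q x := by
  have key : ∀ v ∈ Q, IsMinOn (fun y => ‖x - y‖) Q v → ∀ w ∈ Q, ⟪x - v, w - v⟫_ℝ ≤ 0 := by
    intro v hv h
    rw [← norm_eq_iInf_iff_real_inner_le_zero hcv hv]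
    have : Nonempty Q := ⟨⟨v, hv⟩⟩
    exact le_antisymm (le_ciInf fun w => h w.2)
      (ciInf_le ⟨0, Set.forall_mem_range.2 fun _ => norm_nonneg _⟩ (⟨v, hv⟩ : Q))
  obtain ⟨hp, hpm⟩ := proj_spec ⟨y, hy⟩ hcl hcv x
  have h1 := key y hy hmin _ hp
  have h2 := key _ hp hpm y hy
  have h3 : ⟪y - proj Q x, y - proj Q x⟫_ℝ ≤ 0 := by
    have e : y - proj Q x = (x - proj Q x) - (x - y) := by abel
    have e' : ⟪y - proj Q x, y - proj Q x⟫_ℝ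
        = ⟪x - proj Q x, y - proj Q x⟫_ℝ + ⟪x - y, proj Q x - y⟫_ℝ := by
      conv_lhs => rw [e]
      rw [inner_sub_left, ← e, ← neg_sub y (proj Q x), inner_neg_right, sub_eq_add_neg]
    linarith
  rw [real_inner_self_eq_norm_sq] at h3
  have h4 : ‖y - proj Q x‖ = 0 := by
    refine (pow_eq_zero_iff two_ne_zero).1 (le_antisymm h3 (sq_nonneg _))
  exact sub_eq_zero.1 (norm_eq_zero.1 h4)

end Projection

theorem rho_spec {N : ℕ} {P : Set (Fin N → ℝ)} (hne : P.Nonempty) (hcl : IsClosed P)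
    (hP : P ⊆ stdSimplex ℝ (Fin N)) (α β : Fin N → ℝ) :
    rho P α β ∈ P ∧ IsMinOn (fun p : Fin N → ℝ => (1 / 2) * ∑ i, p i ^ 2 * α i - ∑ i, p i * β i)
      P (rho P α β) := by
  apply argmin_spec
  exact ((isCompact_stdSimplex ℝ (Fin N)).of_isClosed_subset hcl hP).exists_isMinOn hne
    (by fun_prop)

theorem eq_rho {N : ℕ} {P : Set (Fin N → ℝ)} (hcl : IsClosed P) (hcv : Convex ℝ P)
    (hP : P ⊆ stdSimplex ℝ (Fin N)) {α β : Fin N → ℝ} (hα : ∀ i, 0 < α i) {p : Fin N → ℝ}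
    (hp : p ∈ P)
    (hmin : IsMinOn (fun p : Fin N → ℝ => (1 / 2) * ∑ i, p i ^ 2 * α i - ∑ i, p i * β i) P p) :
    p = rho P α β := by
  obtain ⟨hq, hqm⟩ := rho_spec ⟨p, hp⟩ hcl hP α β
  set q := rho P α β
  have hm : (1 / 2 : ℝ) • p + (1 / 2 : ℝ) • q ∈ P :=
    hcv hp hq (by norm_num) (by norm_num) (by norm_num)
  have h1 := isMinOn_iff.1 hmin _ hm
  have h2 := isMinOn_iff.1 hqm _ hm
  have e1 : ∑ i, ((1 / 2 : ℝ) • p + (1 / 2 : ℝ) • q) i ^ 2 * α i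
      = (1 / 2) * ∑ i, p i ^ 2 * α i + (1 / 2) * ∑ i, q i ^ 2 * α i
        - (1 / 4) * ∑ i, (p i - q i) ^ 2 * α i := by
    simp only [Finset.mul_sum, ← Finset.sum_add_distrib, ← Finset.sum_sub_distrib]
    refine Finset.sum_congr rfl fun i _ => ?_
    simp only [Pi.add_apply, Pi.smul_apply, smul_eq_mul]
    ring
  have e2 : ∑ i, ((1 / 2 : ℝ) • p + (1 / 2 : ℝ) • q) i * β i
      = (1 / 2) * ∑ i, p i * β i + (1 / 2) * ∑ i, q i * β i := by
    simp only [Finset.mul_sum, ← Finset.sum_add_distrib]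
    refine Finset.sum_congr rfl fun i _ => ?_
    simp only [Pi.add_apply, Pi.smul_apply, smul_eq_mul]
    ring
  simp only [e1, e2] at h1 h2
  have hnn : ∀ i ∈ Finset.univ, 0 ≤ (p i - q i) ^ 2 * α i :=
    fun i _ => mul_nonneg (sq_nonneg _) (hα i).le
  have h0 : ∑ i, (p i - q i) ^ 2 * α i = 0 :=
    le_antisymm (by linarith) (Finset.sum_nonneg hnn)
  funext i
  have hi := (Finset.sum_eq_zero_iff_of_nonneg hnn).1 h0 i (Finset.mem_univ i)
  rcases mul_eq_zero.1 hi with h | h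
  · exact sub_eq_zero.1 (pow_eq_zero_iff two_ne_zero |>.1 h)
  · exact absurd h (hα i).ne'

section Convex

variable {E : Type*} [NormedAddCommGroup E] [InnerProductSpace ℝ E]

/-- The convex subdifferential `∂f(x)` of a real-valued function. -/
def subdifferential (f : E → ℝ) (x : E) : Set E :=
  {g | ∀ z, f x + ⟪g, z - x⟫_ℝ ≤ f z}

/-- The normal cone `N_C(x)` to a convex set, empty if `x ∉ C`. -/
def normalCone (C : Set E) (x : E) : Set E :=
  {u | x ∈ C ∧ ∀ z ∈ C, ⟪u, z - x⟫_ℝ ≤ 0}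

end Convex

section Problem

variable {E : Type*} [NormedAddCommGroup E] [InnerProductSpace ℝ E] {N : ℕ}

/-- The product `Q₁ × ⋯ × Q_N ⊆ E ^ N`. -/
def box (Q : Fin N → Set E) : Set (Pow E N) := {x | ∀ i, x i ∈ Q i}

/-- `f(x) = sup_{p ∈ P} ∑ pᵢ (⟪aᵢ, xᵢ⟫ + ξᵢ)`. -/
noncomputable def supFun (P : Set (Fin N → ℝ)) (a : Fin N → E) (ξ : Fin N → ℝ) (x : Pow E N) : ℝ :=
  ⨆ p : P, ∑ i, (p : Fin N → ℝ) i * (⟪a i, x i⟫_ℝ + ξ i)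

/-- `x` solves: minimize `H(x) + sup_{p ∈ P} ∑ pᵢ (⟪aᵢ, xᵢ⟫ + ξᵢ)` subject to
`x ∈ V ∩ (Q₁ × ⋯ × Q_N)`. -/
def IsSolution (V : Submodule ℝ (Pow E N)) (Q : Fin N → Set E) (P : Set (Fin N → ℝ))
    (H : Pow E N → ℝ) (a : Fin N → E) (ξ : Fin N → ℝ) (x : Pow E N) : Prop :=
  x ∈ (V : Set (Pow E N)) ∩ box Q ∧
    IsMinOn (fun z => H z + supFun P a ξ z) ((V : Set (Pow E N)) ∩ box Q) x

/-- The optimality condition `0 ∈ ∂f(x) + N_Q(x) + ∇H(x) + N_V(x)`, where `Q = Q₁ × ⋯ × Q_N`. -/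
def IsKKTPoint [CompleteSpace E] (V : Submodule ℝ (Pow E N)) (Q : Fin N → Set E)
    (P : Set (Fin N → ℝ)) (H : Pow E N → ℝ) (a : Fin N → E) (ξ : Fin N → ℝ) (x : Pow E N) : Prop :=
  ∃ g ∈ subdifferential (supFun P a ξ) x, ∃ u ∈ normalCone (box Q) x,
    ∃ v ∈ normalCone (V : Set (Pow E N)) x, g + u + ∇ H x + v = 0

/-- The sequences `x, xbar, y, zbar, u, w` in `E ^ N` and `p` in `ℝ ^ N` are generated by the
primal-dual routine with step sizes `lam` and `gam`. -/
structure IsGenerated [CompleteSpace E] (V : Submodule ℝ (Pow E N)) (Q : Fin N → Set E)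
    (P : Set (Fin N → ℝ)) (H : Pow E N → ℝ) (a : Fin N → E) (ξ : Fin N → ℝ) (lam gam : ℝ)
    (x xbar y zbar u w : ℕ → Pow E N) (p : ℕ → Fin N → ℝ) : Prop where
  x_zero : x 0 ∈ V
  xbar_zero : xbar 0 = x 0
  y_zero : y 0 ∈ Vᗮ
  u_succ : ∀ k i, u (k + 1) i =
    u k i + gam • xbar k i - gam • proj (Q i) (gam⁻¹ • u k i + xbar k i)
  zbar_eq : ∀ k, zbar k =
    x k + lam • y k - lam • proj (V : Set (Pow E N)) (u (k + 1) + ∇ H (x k))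
  p_eq : ∀ k, p k = rho P (fun i => lam * ‖a i‖ ^ 2) (fun i => ⟪a i, zbar k i⟫_ℝ + ξ i)
  w_succ : ∀ k i, w (k + 1) i = zbar k i - (lam * p k i) • a i
  x_succ : ∀ k, x (k + 1) = proj (V : Set (Pow E N)) (w (k + 1))
  y_succ : ∀ k, y (k + 1) = y k + lam⁻¹ • (x (k + 1) - w (k + 1))
  xbar_succ : ∀ k, xbar (k + 1) = (2 : ℝ) • x (k + 1) - x k

end Problem

end DRO

namespace DRO

section WeakConvergence

variable {F : Type*} [NormedAddCommGroup F] [InnerProductSpace ℝ F] {ι : Type*}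

/-- Weak convergence of `x` to `a` along the filter `l`, expressed through inner products. -/
def WeakLim (x : ι → F) (l : Filter ι) (a : F) : Prop :=
  ∀ v, Tendsto (fun k => ⟪x k, v⟫_ℝ) l (𝓝 ⟪a, v⟫_ℝ)

theorem WeakLim.add {x y : ι → F} {l : Filter ι} {a b : F} (hx : WeakLim x l a)
    (hy : WeakLim y l b) : WeakLim (fun k => x k + y k) l (a + b) := fun v => by
  simpa only [inner_add_left] using (hx v).add (hy v)

theorem WeakLim.sub {x y : ι → F} {l : Filter ι} {a b : F} (hx : WeakLim x l a)
    (hy : WeakLim y l b) : WeakLim (fun k => x k - y k) l (a - b) := fun v => by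
  simpa only [inner_sub_left] using (hx v).sub (hy v)

theorem WeakLim.of_tendsto {x : ι → F} {l : Filter ι} {a : F} (hx : Tendsto x l (𝓝 a)) :
    WeakLim x l a := fun _ => hx.inner tendsto_const_nhds

theorem WeakLim.congr_sub {x y : ι → F} {l : Filter ι} {a : F} (hx : WeakLim x l a)
    (h : Tendsto (fun k => y k - x k) l (𝓝 0)) : WeakLim y l a := by
  have := hx.add (WeakLim.of_tendsto h)
  simpa using this

theorem WeakLim.starProjection {V : Submodule ℝ F} [V.HasOrthogonalProjection] {x : ι → F}
    {l : Filter ι} {a : F} (hx : WeakLim x l a) :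
    WeakLim (fun k => V.starProjection (x k)) l (V.starProjection a) := fun v => by
  simpa only [V.inner_starProjection_left_eq_right] using hx (V.starProjection v)

theorem WeakLim.tendsto_sq_norm_sub_sub {l : Filter ι} {x : ι → F} {z : F}
    (hx : WeakLim x l z) (a b : F) :
    Tendsto (fun k => ‖x k - a‖ ^ 2 - ‖x k - b‖ ^ 2) l (𝓝 (‖z - a‖ ^ 2 - ‖z - b‖ ^ 2)) := by
  have e : ∀ v : F, ‖v - a‖ ^ 2 - ‖v - b‖ ^ 2
      = 2 * ⟪v, b - a⟫_ℝ + (‖a‖ ^ 2 - ‖b‖ ^ 2) := fun v => by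
    rw [norm_sub_sq_real, norm_sub_sq_real, inner_sub_right]
    ring
  simp only [e]
  exact ((hx _).const_mul 2).add_const _

theorem tendsto_inner_of_bounded_of_tendsto_zero {x y : ι → F} {l : Filter ι} {C : ℝ}
    (hx : ∀ k, ‖x k‖ ≤ C) (hy : Tendsto y l (𝓝 0)) :
    Tendsto (fun k => ⟪x k, y k⟫_ℝ) l (𝓝 0) := by
  refine squeeze_zero_norm (a := fun k => C * ‖y k‖) (fun k => ?_) ?_
  · exact (norm_inner_le_norm _ _).trans (mul_le_mul_of_nonneg_right (hx k) (norm_nonneg _))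
  · simpa using (tendsto_norm_zero.comp hy).const_mul C

theorem tendsto_zero_of_sq_norm {F ι : Type*} [NormedAddCommGroup F] {x : ι → F} {l : Filter ι}
    (h : Tendsto (fun k => ‖x k‖ ^ 2) l (𝓝 0)) : Tendsto x l (𝓝 0) := by
  rw [tendsto_zero_iff_norm_tendsto_zero]
  simpa [Real.sqrt_sq] using h.sqrt

/-- Bounded families in a Hilbert space converge weakly along every ultrafilter. -/
theorem exists_weakLim [CompleteSpace F] (l : Ultrafilter ι) {x : ι → F} {C : ℝ}
    (hx : ∀ k, ‖x k‖ ≤ C) : ∃ a, WeakLim x l a := by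
  have hb : ∀ v k, |⟪x k, v⟫_ℝ| ≤ C * ‖v‖ := fun v k =>
    (abs_real_inner_le_norm _ _).trans (mul_le_mul_of_nonneg_right (hx k) (norm_nonneg _))
  have hlim : ∀ v, ∃ c, Tendsto (fun k => ⟪x k, v⟫_ℝ) l (𝓝 c) := by
    intro v
    obtain ⟨c, -, hc⟩ := (isCompact_Icc (a := -(C * ‖v‖)) (b := C * ‖v‖)).ultrafilter_le_nhds
      (l.map fun k => ⟪x k, v⟫_ℝ)
      (le_principal_iff.2 (mem_map.2 (univ_mem' fun k => abs_le.1 (hb v k))))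
    exact ⟨c, hc⟩
  choose φ hφ using hlim
  have hadd : ∀ v w, φ (v + w) = φ v + φ w := fun v w =>
    tendsto_nhds_unique (hφ _) (by simpa only [inner_add_right] using (hφ v).add (hφ w))
  have hsmul : ∀ (c : ℝ) v, φ (c • v) = c • φ v := fun c v =>
    tendsto_nhds_unique (hφ _) (by
      simpa only [real_inner_smul_right, smul_eq_mul] using (hφ v).const_mul c)
  let T : StrongDual ℝ F := LinearMap.mkContinuous
    { toFun := φ, map_add' := hadd, map_smul' := hsmul } C fun v =>
      le_of_tendsto (hφ v).norm (Eventually.of_forall fun k => hb v k)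
  refine ⟨(InnerProductSpace.toDual ℝ F).symm T, fun v => ?_⟩
  rw [InnerProductSpace.toDual_symm_apply]
  exact hφ v

theorem WeakLim.tendsto_toWeakSpace [CompleteSpace F] {x : ι → F} {l : Filter ι} {a : F}
    (h : WeakLim x l a) :
    Tendsto (fun k => toWeakSpace ℝ F (x k)) l (𝓝 (toWeakSpace ℝ F a)) := by
  refine (WeakBilin.tendsto_iff_forall_eval_tendsto (topDualPairing ℝ F).flip ?_).2 fun T => ?_
  · intro y z hyz
    exact (InnerProductSpace.toDual ℝ F).injective (by
      ext v
      have := congrArg (fun (f : StrongDual ℝ F →ₗ[ℝ] ℝ) => f (InnerProductSpace.toDual ℝ F v)) hyz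
      have h2 : ⟪v, y⟫_ℝ = ⟪v, z⟫_ℝ := this
      simpa [real_inner_comm] using h2)
  · have := h ((InnerProductSpace.toDual ℝ F).symm T)
    simp only [real_inner_comm ((InnerProductSpace.toDual ℝ F).symm T),
      InnerProductSpace.toDual_symm_apply] at this
    exact this

end WeakConvergence

section Projection

variable {F : Type*} [NormedAddCommGroup F] [InnerProductSpace ℝ F] [CompleteSpace F]

theorem inner_sub_proj_le_zero {Q : Set F} (hne : Q.Nonempty) (hcl : IsClosed Q)
    (hcv : Convex ℝ Q) (x : F) {z : F} (hz : z ∈ Q) : ⟪x - proj Q x, z - proj Q x⟫_ℝ ≤ 0 := by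
  obtain ⟨hp, hm⟩ := proj_spec hne hcl hcv x
  refine (norm_eq_iInf_iff_real_inner_le_zero hcv hp).1 ?_ z hz
  have : Nonempty Q := ⟨⟨z, hz⟩⟩
  exact le_antisymm (le_ciInf fun w => hm w.2)
    (ciInf_le ⟨0, Set.forall_mem_range.2 fun _ => norm_nonneg _⟩ (⟨_, hp⟩ : Q))

theorem proj_submodule (V : Submodule ℝ F) [V.HasOrthogonalProjection]
    (hV : IsClosed (V : Set F)) (x : F) : proj (V : Set F) x = V.starProjection x := by
  obtain ⟨hp, -⟩ := proj_spec (Q := (V : Set F)) ⟨0, V.zero_mem⟩ hV V.convex x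
  refine (Submodule.eq_starProjection_of_mem_of_inner_eq_zero hp fun v hv => ?_).symm
  have h := fun z (hz : z ∈ V) => inner_sub_proj_le_zero (Q := (V : Set F)) ⟨0, V.zero_mem⟩ hV
    V.convex x (z := z) hz
  have h1 := h _ (V.add_mem hp hv)
  have h2 := h _ (V.sub_mem hp hv)
  simp only [add_sub_cancel_left, sub_sub_cancel_left, inner_neg_right] at h1 h2
  linarith

/-- Closed convex sets are weakly closed. -/
theorem WeakLim.mem_of_forall_mem {ι : Type*} {l : Filter ι} [l.NeBot] {x : ι → F} {a : F}
    (hx : WeakLim x l a) {Q : Set F} (hcl : IsClosed Q) (hcv : Convex ℝ Q)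
    (hmem : ∀ k, x k ∈ Q) : a ∈ Q := by
  obtain ⟨k₀⟩ : Nonempty ι := l.nonempty_of_neBot
  have hne : Q.Nonempty := ⟨_, hmem k₀⟩
  have h := (hx (a - proj Q a)).sub_const ⟪proj Q a, a - proj Q a⟫_ℝ
  simp only [← inner_sub_left] at h
  have h0 : ⟪a - proj Q a, a - proj Q a⟫_ℝ ≤ 0 := le_of_tendsto h (Eventually.of_forall fun k => by
    rw [real_inner_comm]
    exact inner_sub_proj_le_zero hne hcl hcv a (hmem k))
  rw [real_inner_self_nonpos, sub_eq_zero] at h0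
  rw [h0]
  exact (proj_spec hne hcl hcv a).1

end Projection

section Gradient

variable {F : Type*} [NormedAddCommGroup F] [InnerProductSpace ℝ F] [CompleteSpace F]
  {H : F → ℝ}

theorem hasDerivAt_comp_line (hd : Differentiable ℝ H) (x v : F) (t : ℝ) :
    HasDerivAt (fun s : ℝ => H (x + s • v)) ⟪∇ H (x + t • v), v⟫_ℝ t := by
  have h1 : HasDerivAt (fun s : ℝ => x + s • v) v t := by
    simpa using ((hasDerivAt_id t).smul_const v).const_add x
  have h2 := (hd (x + t • v)).hasGradientAt.hasFDerivAt.comp_hasDerivAt t h1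
  rwa [InnerProductSpace.toDual_apply_apply] at h2

theorem gradient_mem_subdifferential (hcv : ConvexOn ℝ Set.univ H) (hd : Differentiable ℝ H)
    (x : F) : ∇ H x ∈ subdifferential H x := by
  intro z
  have hc : ConvexOn ℝ Set.univ (fun s : ℝ => H (x + s • (z - x))) := by
    have := hcv.comp_affineMap (AffineMap.lineMap (k := ℝ) x z)
    simpa [Function.comp_def, AffineMap.lineMap_apply, add_comm] using this
  have h := hc.le_slope_of_hasDerivAt (Set.mem_univ 0) (Set.mem_univ 1) one_pos
    (hasDerivAt_comp_line hd x (z - x) 0)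
  rw [slope_def_field, zero_smul, add_zero, one_smul, add_sub_cancel, sub_zero, div_one] at h
  linarith

/-- The descent lemma. -/
theorem le_of_lipschitz_gradient (hd : Differentiable ℝ H) {L : ℝ}
    (hL : ∀ x z, ‖∇ H x - ∇ H z‖ ≤ L * ‖x - z‖) (x v : F) :
    H (x + v) ≤ H x + ⟪∇ H x, v⟫_ℝ + L / 2 * ‖v‖ ^ 2 := by
  have hder : ∀ t : ℝ, HasDerivAt
      (fun s : ℝ => H (x + s • v) - s * ⟪∇ H x, v⟫_ℝ - s ^ 2 * (L / 2 * ‖v‖ ^ 2))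
      (⟪∇ H (x + t • v), v⟫_ℝ - ⟪∇ H x, v⟫_ℝ - 2 * t * (L / 2 * ‖v‖ ^ 2)) t := by
    intro t
    have h1 := ((hasDerivAt_id t).mul_const ⟪∇ H x, v⟫_ℝ)
    have h2 := ((hasDerivAt_pow 2 t).mul_const (L / 2 * ‖v‖ ^ 2))
    exact (((hasDerivAt_comp_line hd x v t).sub h1).sub h2).congr_deriv (by norm_num)
  have hanti := antitoneOn_of_deriv_nonpos (convex_Icc (0 : ℝ) 1)
    (fun t _ => (hder t).continuousAt.continuousWithinAt)
    (fun t _ => (hder t).differentiableAt.differentiableWithinAt) (fun t ht => by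
      rw [interior_Icc] at ht
      rw [(hder t).deriv, ← inner_sub_left]
      have h1 := real_inner_le_norm (∇ H (x + t • v) - ∇ H x) v
      have h2 := mul_le_mul_of_nonneg_right (hL (x + t • v) x) (norm_nonneg v)
      rw [add_sub_cancel_left, norm_smul, Real.norm_of_nonneg ht.1.le] at h2
      linarith)
  have := hanti (Set.left_mem_Icc.2 zero_le_one) (Set.right_mem_Icc.2 zero_le_one) zero_le_one
  simp only [one_smul, zero_smul, add_zero] at this
  linarith

theorem lower_bound_of_lipschitz_gradient (hcv : ConvexOn ℝ Set.univ H) (hd : Differentiable ℝ H)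
    {β : ℝ} (hβ : 0 < β) (hL : ∀ x z, ‖∇ H x - ∇ H z‖ ≤ β⁻¹ * ‖x - z‖) (x z : F) :
    H x + ⟪∇ H x, z - x⟫_ℝ + β / 2 * ‖∇ H z - ∇ H x‖ ^ 2 ≤ H z := by
  set d := ∇ H z - ∇ H x with hdd
  have h1 := le_of_lipschitz_gradient hd hL z (-(β • d))
  have h2 := gradient_mem_subdifferential hcv hd x (z + -(β • d))
  have e1 : ⟪∇ H x, z + -(β • d) - x⟫_ℝ = ⟪∇ H x, z - x⟫_ℝ - β * ⟪∇ H x, d⟫_ℝ := by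
    rw [show z + -(β • d) - x = (z - x) - β • d by abel, inner_sub_right, real_inner_smul_right]
  have e2 : ⟪∇ H z, d⟫_ℝ - ⟪∇ H x, d⟫_ℝ = ‖d‖ ^ 2 := by
    rw [← inner_sub_left, ← hdd, real_inner_self_eq_norm_sq]
  rw [e1] at h2
  rw [inner_neg_right, real_inner_smul_right, norm_neg, norm_smul, Real.norm_of_nonneg hβ.le] at h1
  have e3 : β⁻¹ / 2 * (β * ‖d‖) ^ 2 = β / 2 * ‖d‖ ^ 2 := by field_simp
  rw [e3] at h1
  have e4 : β * ⟪∇ H z, d⟫_ℝ - β * ⟪∇ H x, d⟫_ℝ = β * ‖d‖ ^ 2 := by rw [← mul_sub, e2]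
  linarith

/-- The Baillon–Haddad theorem. -/
theorem cocoercive_gradient (hcv : ConvexOn ℝ Set.univ H) (hd : Differentiable ℝ H)
    {β : ℝ} (hβ : 0 < β) (hL : ∀ x z, ‖∇ H x - ∇ H z‖ ≤ β⁻¹ * ‖x - z‖) (x z : F) :
    β * ‖∇ H x - ∇ H z‖ ^ 2 ≤ ⟪∇ H x - ∇ H z, x - z⟫_ℝ := by
  have h1 := lower_bound_of_lipschitz_gradient hcv hd hβ hL x z
  have h2 := lower_bound_of_lipschitz_gradient hcv hd hβ hL z x
  rw [norm_sub_rev] at h1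
  have e : ⟪∇ H x, z - x⟫_ℝ = - ⟪∇ H x, x - z⟫_ℝ := by rw [← inner_neg_right, neg_sub]
  rw [inner_sub_left]
  linarith

theorem eq_gradient_of_mem_subdifferential (hd : Differentiable ℝ H) {x h : F}
    (hh : h ∈ subdifferential H x) : h = ∇ H x := by
  have hmin : IsLocalMin (fun t : ℝ => H (x + t • (h - ∇ H x)) - t * ⟪h, h - ∇ H x⟫_ℝ) 0 :=
    Eventually.of_forall fun t => by
      have := hh (x + t • (h - ∇ H x))
      rw [add_sub_cancel_left, real_inner_smul_right] at this
      simp only [zero_smul, add_zero, zero_mul, sub_zero]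
      linarith
  have hder := (hasDerivAt_comp_line hd x (h - ∇ H x) 0).sub
    ((hasDerivAt_id (0 : ℝ)).mul_const ⟪h, h - ∇ H x⟫_ℝ)
  have h0 := hmin.hasDerivAt_eq_zero hder
  have h1 : ⟪h - ∇ H x, h - ∇ H x⟫_ℝ = 0 := by
    rw [inner_sub_left]
    rw [zero_smul, add_zero, one_mul] at h0
    linarith
  exact sub_eq_zero.1 (inner_self_eq_zero.1 h1)

end Gradient

section Monotone

variable {F : Type*} [NormedAddCommGroup F] [InnerProductSpace ℝ F]

theorem subdifferential_monotone {f : F → ℝ} {x z g h : F} (hg : g ∈ subdifferential f x)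
    (hh : h ∈ subdifferential f z) : 0 ≤ ⟪g - h, x - z⟫_ℝ := by
  have h1 := hg z
  have h2 := hh x
  rw [← neg_sub x z, inner_neg_right] at h1
  rw [inner_sub_left]
  linarith

theorem normalCone_monotone {C : Set F} {x z g h : F} (hg : g ∈ normalCone C x)
    (hh : h ∈ normalCone C z) : 0 ≤ ⟪g - h, x - z⟫_ℝ := by
  have h1 := hg.2 z hh.1
  have h2 := hh.2 x hg.1
  rw [← neg_sub x z, inner_neg_right] at h1
  rw [inner_sub_left]
  linarith

theorem two_mul_inner_sub_sub (a b c : F) :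
    2 * ⟪a - b, b - c⟫_ℝ = ‖a - c‖ ^ 2 - ‖b - c‖ ^ 2 - ‖a - b‖ ^ 2 := by
  rw [← sub_add_sub_cancel a b c, norm_add_sq_real]
  ring

theorem inner_add_sub_starProjection_add {V : Submodule ℝ F} [V.HasOrthogonalProjection]
    {a b c d : F} (ha : a ∈ V) (hb : b ∈ Vᗮ) (hc : c ∈ V) (hd : d ∈ Vᗮ) (s : F) :
    ⟪a + b - V.starProjection s, c + d⟫_ℝ = ⟪a, c⟫_ℝ - ⟪s, c⟫_ℝ + ⟪b, d⟫_ℝ := by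
  rw [inner_sub_left, inner_add_left, inner_add_right, inner_add_right, inner_add_right,
    V.inner_right_of_mem_orthogonal ha hd, V.inner_left_of_mem_orthogonal hc hb,
    V.inner_right_of_mem_orthogonal (V.starProjection_apply_mem s) hd,
    V.inner_starProjection_left_eq_right, V.starProjection_eq_self_iff.2 hc]
  ring

/-- Young's inequality `2 ⟪a, b⟫ ≤ ‖a‖² / c + c ‖b‖²`. -/
theorem two_mul_inner_le {c : ℝ} (hc : 0 < c) (a b : F) :
    2 * ⟪a, b⟫_ℝ ≤ c⁻¹ * ‖a‖ ^ 2 + c * ‖b‖ ^ 2 := by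
  have h : 0 ≤ c⁻¹ * ‖a - c • b‖ ^ 2 := by positivity
  rw [norm_sub_sq_real, real_inner_smul_right, norm_smul, Real.norm_of_nonneg hc.le] at h
  have e : c⁻¹ * (‖a‖ ^ 2 - 2 * (c * ⟪a, b⟫_ℝ) + (c * ‖b‖) ^ 2)
      = c⁻¹ * ‖a‖ ^ 2 - 2 * ⟪a, b⟫_ℝ + c * ‖b‖ ^ 2 := by
    field_simp
  linarith

end Monotone

section Distance

variable {F : Type*} [NormedAddCommGroup F] [InnerProductSpace ℝ F]

/-- The squared distance to `(xs, ys, us)` in the metric of the algorithm. -/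
noncomputable def dist₃ (lam gam : ℝ) (xs ys us x y u : F) : ℝ :=
  lam⁻¹ * ‖x - xs‖ ^ 2 + lam * ‖y - ys‖ ^ 2 + gam⁻¹ * ‖u - us‖ ^ 2

theorem tendsto_dist₃_sub {ι : Type*} {lam gam : ℝ} {l : Filter ι} {xs ys us : F}
    {x y u : ι → F} (hx : WeakLim x l xs)
    (hy : WeakLim y l ys) (hu : WeakLim u l us) (a₁ a₂ a₃ b₁ b₂ b₃ : F) :
    Tendsto (fun k => dist₃ lam gam a₁ a₂ a₃ (x k) (y k) (u k)
        - dist₃ lam gam b₁ b₂ b₃ (x k) (y k) (u k)) l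
      (𝓝 (dist₃ lam gam a₁ a₂ a₃ xs ys us - dist₃ lam gam b₁ b₂ b₃ xs ys us)) := by
  have e : ∀ v₁ v₂ v₃ : F, dist₃ lam gam a₁ a₂ a₃ v₁ v₂ v₃ - dist₃ lam gam b₁ b₂ b₃ v₁ v₂ v₃
      = lam⁻¹ * (‖v₁ - a₁‖ ^ 2 - ‖v₁ - b₁‖ ^ 2) + lam * (‖v₂ - a₂‖ ^ 2 - ‖v₂ - b₂‖ ^ 2)
        + gam⁻¹ * (‖v₃ - a₃‖ ^ 2 - ‖v₃ - b₃‖ ^ 2) := fun v₁ v₂ v₃ => by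
    simp only [dist₃]
    ring
  simp only [e]
  exact (((hx.tendsto_sq_norm_sub_sub a₁ b₁).const_mul _).add
    ((hy.tendsto_sq_norm_sub_sub a₂ b₂).const_mul _)).add
    ((hu.tendsto_sq_norm_sub_sub a₃ b₃).const_mul _)

end Distance

section Abstract

variable {F : Type*} [NormedAddCommGroup F] [InnerProductSpace ℝ F] [CompleteSpace F]

/-- Primal-dual solutions of `0 ∈ ∂f(x) + N_C(x) + ∇H(x) + N_V(x)`. -/
structure IsPrimalDual (V : Submodule ℝ F) [V.HasOrthogonalProjection] (C : Set F) (f H : F → ℝ)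
    (x y u : F) : Prop where
  mem : x ∈ V
  mem_orthogonal : y ∈ Vᗮ
  mem_subdifferential : y - V.starProjection (u + ∇ H x) ∈ subdifferential f x
  mem_normalCone : u ∈ normalCone C x

/-- Sequences generated by the primal-dual algorithm, in terms of the inclusions they satisfy. -/
structure IsPrimalDualSeq (V : Submodule ℝ F) [V.HasOrthogonalProjection] (C : Set F)
    (f H : F → ℝ) (lam gam : ℝ) (x y u : ℕ → F) : Prop where
  mem : ∀ k, x k ∈ V
  mem_orthogonal : ∀ k, y k ∈ Vᗮ
  mem_subdifferential : ∀ k,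
    lam⁻¹ • (x k - x (k + 1)) + y (k + 1) - V.starProjection (u (k + 1) + ∇ H (x k)) ∈
      subdifferential f (x (k + 1) + lam • (y k - y (k + 1)))
  mem_normalCone : ∀ k,
    u (k + 1) ∈ normalCone C (gam⁻¹ • (u k - u (k + 1)) + ((2 : ℝ) • x k - x (k - 1)))

variable {V : Submodule ℝ F} [V.HasOrthogonalProjection] {C : Set F} {f H : F → ℝ}
  {lam gam β : ℝ} {x y u : ℕ → F} {xs ys us : F}

theorem IsPrimalDualSeq.dist₃_succ_le (hseq : IsPrimalDualSeq V C f H lam gam x y u)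
    (hs : IsPrimalDual V C f H xs ys us) (hHcv : ConvexOn ℝ Set.univ H)
    (hHd : Differentiable ℝ H) (hβ : 0 < β) (hHL : ∀ x z, ‖∇ H x - ∇ H z‖ ≤ β⁻¹ * ‖x - z‖)
    {c : ℝ} (hc : 0 < c) (k : ℕ) :
    dist₃ lam gam xs ys us (x (k + 1)) (y (k + 1)) (u (k + 1))
        + 2 * ⟪u (k + 1) - us, x (k + 1) - x k⟫_ℝ
        + (1 / lam - 1 / (2 * β)) * ‖x (k + 1) - x k‖ ^ 2 + lam * ‖y (k + 1) - y k‖ ^ 2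
        + (gam⁻¹ - c⁻¹) * ‖u (k + 1) - u k‖ ^ 2
      ≤ dist₃ lam gam xs ys us (x k) (y k) (u k) + 2 * ⟪u k - us, x k - x (k - 1)⟫_ℝ
        + c * ‖x k - x (k - 1)‖ ^ 2 := by
  set s := u (k + 1) + ∇ H (x k)
  set d := ∇ H (x k) - ∇ H xs with hd
  have m1 := subdifferential_monotone (hseq.mem_subdifferential k) hs.mem_subdifferential
  have m2 := normalCone_monotone (hseq.mem_normalCone k) hs.mem_normalCone
  have e1 : ⟪lam⁻¹ • (x k - x (k + 1)) + y (k + 1) - V.starProjection s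
        - (ys - V.starProjection (us + ∇ H xs)), x (k + 1) + lam • (y k - y (k + 1)) - xs⟫_ℝ
      = lam⁻¹ * ⟪x k - x (k + 1), x (k + 1) - xs⟫_ℝ
        - (⟪u (k + 1) - us, x (k + 1) - xs⟫_ℝ + ⟪d, x (k + 1) - xs⟫_ℝ)
        + lam * ⟪y k - y (k + 1), y (k + 1) - ys⟫_ℝ := by
    rw [show lam⁻¹ • (x k - x (k + 1)) + y (k + 1) - V.starProjection s
        - (ys - V.starProjection (us + ∇ H xs))
        = lam⁻¹ • (x k - x (k + 1)) + (y (k + 1) - ys)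
          - V.starProjection (s - (us + ∇ H xs)) by rw [map_sub]; abel,
      show x (k + 1) + lam • (y k - y (k + 1)) - xs
        = (x (k + 1) - xs) + lam • (y k - y (k + 1)) by abel,
      inner_add_sub_starProjection_add
        (V.smul_mem _ (V.sub_mem (hseq.mem _) (hseq.mem _)))
        (Vᗮ.sub_mem (hseq.mem_orthogonal _) hs.mem_orthogonal) (V.sub_mem (hseq.mem _) hs.mem)
        (Vᗮ.smul_mem _ (Vᗮ.sub_mem (hseq.mem_orthogonal _) (hseq.mem_orthogonal _))),
      real_inner_smul_left, real_inner_smul_right,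
      real_inner_comm (y k - y (k + 1)), ← inner_add_left,
      show s - (us + ∇ H xs) = u (k + 1) - us + d by simp only [s, d]; abel]
  have e2 : ⟪u (k + 1) - us, gam⁻¹ • (u k - u (k + 1)) + ((2 : ℝ) • x k - x (k - 1)) - xs⟫_ℝ
      = gam⁻¹ * ⟪u k - u (k + 1), u (k + 1) - us⟫_ℝ + ⟪u k - us, x k - x (k - 1)⟫_ℝ
        + ⟪u (k + 1) - u k, x k - x (k - 1)⟫_ℝ - ⟪u (k + 1) - us, x (k + 1) - x k⟫_ℝ
        + ⟪u (k + 1) - us, x (k + 1) - xs⟫_ℝ := by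
    rw [real_inner_comm (u (k + 1) - us) (u k - u (k + 1)), ← real_inner_smul_right,
      add_assoc (inner ℝ _ _), ← inner_add_left,
      show u k - us + (u (k + 1) - u k) = u (k + 1) - us by abel, ← inner_add_right,
      ← inner_sub_right, ← inner_add_right]
    congr 1
    rw [two_smul]
    abel
  have e3 : ⟪d, x (k + 1) - xs⟫_ℝ = ⟪d, x (k + 1) - x k⟫_ℝ + ⟪d, x k - xs⟫_ℝ := by
    rw [← inner_add_right, sub_add_sub_cancel]
  have b1 := cocoercive_gradient hHcv hHd hβ hHL (x k) xs
  rw [← hd] at b1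
  have b2 : -(2 * ⟪d, x (k + 1) - x k⟫_ℝ)
      ≤ 2 * β * ‖d‖ ^ 2 + 1 / (2 * β) * ‖x (k + 1) - x k‖ ^ 2 := by
    have := two_mul_inner_le (c := 1 / (2 * β)) (by positivity) (-d) (x (k + 1) - x k)
    rw [inner_neg_left, norm_neg, one_div, inv_inv, ← one_div] at this
    linarith
  have b3 := two_mul_inner_le hc (u (k + 1) - u k) (x k - x (k - 1))
  rw [e1] at m1
  rw [e2] at m2
  have p1 := congrArg (lam⁻¹ * ·) (two_mul_inner_sub_sub (x k) (x (k + 1)) xs)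
  have p2 := congrArg (lam * ·) (two_mul_inner_sub_sub (y k) (y (k + 1)) ys)
  have p3 := congrArg (gam⁻¹ * ·) (two_mul_inner_sub_sub (u k) (u (k + 1)) us)
  simp only [norm_sub_rev (x k) (x (k + 1)), norm_sub_rev (y k) (y (k + 1)),
    norm_sub_rev (u k) (u (k + 1))] at p1 p2 p3
  simp only [dist₃, one_div] at *
  linarith

/-- Every distance to a primal-dual solution converges, and consecutive iterates approach each
other. -/
theorem IsPrimalDualSeq.tendsto (hseq : IsPrimalDualSeq V C f H lam gam x y u)
    (hs : IsPrimalDual V C f H xs ys us) (hHcv : ConvexOn ℝ Set.univ H)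
    (hHd : Differentiable ℝ H) (hβ : 0 < β) (hHL : ∀ x z, ‖∇ H x - ∇ H z‖ ≤ β⁻¹ * ‖x - z‖)
    (hlam : 0 < lam) (hgam : 0 < gam) (hgam' : gam < 1 / lam - 1 / (2 * β)) :
    (∃ R, ∀ k, ‖x k‖ ≤ R ∧ ‖y k‖ ≤ R ∧ ‖u k‖ ≤ R) ∧
    Tendsto (fun k => x (k + 1) - x k) atTop (𝓝 0) ∧
    Tendsto (fun k => y (k + 1) - y k) atTop (𝓝 0) ∧
    Tendsto (fun k => u (k + 1) - u k) atTop (𝓝 0) ∧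
    ∃ L, Tendsto (fun k => dist₃ lam gam xs ys us (x k) (y k) (u k)) atTop (𝓝 L) := by
  obtain ⟨c, hc1, hc2⟩ := exists_between hgam'
  have hc : 0 < c := hgam.trans hc1
  have hcinv : 0 < gam⁻¹ - c⁻¹ := sub_pos.2 (inv_strictAnti₀ hgam hc1)
  set A := fun k => dist₃ lam gam xs ys us (x k) (y k) (u k) with hA
  set e := fun k => A k + 2 * ⟪u k - us, x k - x (k - 1)⟫_ℝ + c * ‖x k - x (k - 1)‖ ^ 2 with he
  set r := fun k => (1 / lam - 1 / (2 * β) - c) * ‖x (k + 1) - x k‖ ^ 2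
    + lam * ‖y (k + 1) - y k‖ ^ 2 + (gam⁻¹ - c⁻¹) * ‖u (k + 1) - u k‖ ^ 2 with hr
  have hstep : ∀ k, e (k + 1) + r k ≤ e k := fun k => by
    have := hseq.dist₃_succ_le (gam := gam) hs hHcv hHd hβ hHL hc k
    simp only [he, hr, hA, Nat.add_sub_cancel]
    linarith
  have hcl : 0 < 1 / lam - 1 / (2 * β) - c := sub_pos.2 hc2
  have hr0 : ∀ k, 0 ≤ r k := fun k => by positivity
  have hlow : ∀ k, lam⁻¹ * ‖x k - xs‖ ^ 2 + lam * ‖y k - ys‖ ^ 2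
      + (gam⁻¹ - c⁻¹) * ‖u k - us‖ ^ 2 ≤ e k := fun k => by
    have := two_mul_inner_le hc (-(u k - us)) (x k - x (k - 1))
    rw [inner_neg_left, norm_neg] at this
    simp only [he, hA, dist₃]
    linarith
  have hanti : Antitone e := antitone_nat_of_succ_le fun k => by linarith [hstep k, hr0 k]
  have he0 : ∀ k, 0 ≤ e k := fun k => le_trans (by positivity) (hlow k)
  have hlim := tendsto_atTop_ciInf hanti ⟨0, Set.forall_mem_range.2 he0⟩
  have hrlim : Tendsto r atTop (𝓝 0) := by
    refine squeeze_zero hr0 (g := fun k => e k - e (k + 1)) (fun k => by linarith [hstep k]) ?_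
    simpa using hlim.sub (hlim.comp (tendsto_add_atTop_nat 1))
  have hsq : ∀ (z : ℕ → F) (t : ℝ), 0 < t → (∀ k, t * ‖z k‖ ^ 2 ≤ r k) →
      Tendsto z atTop (𝓝 0) := fun z t ht hz => by
    refine tendsto_zero_of_sq_norm (squeeze_zero (fun _ => by positivity)
      (fun k => (le_inv_mul_iff₀ ht).2 (hz k)) ?_)
    simpa using hrlim.const_mul t⁻¹
  have hdx : Tendsto (fun k => x (k + 1) - x k) atTop (𝓝 0) := hsq _ _ hcl fun k => by
    have h1 : 0 ≤ lam * ‖y (k + 1) - y k‖ ^ 2 := by positivity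
    have h2 : 0 ≤ (gam⁻¹ - c⁻¹) * ‖u (k + 1) - u k‖ ^ 2 := by positivity
    simp only [hr]
    linarith
  have hdy : Tendsto (fun k => y (k + 1) - y k) atTop (𝓝 0) := hsq _ _ hlam fun k => by
    have h1 : 0 ≤ (1 / lam - 1 / (2 * β) - c) * ‖x (k + 1) - x k‖ ^ 2 := by positivity
    have h2 : 0 ≤ (gam⁻¹ - c⁻¹) * ‖u (k + 1) - u k‖ ^ 2 := by positivity
    simp only [hr]
    linarith
  have hdu : Tendsto (fun k => u (k + 1) - u k) atTop (𝓝 0) := hsq _ _ hcinv fun k => by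
    have h1 : 0 ≤ (1 / lam - 1 / (2 * β) - c) * ‖x (k + 1) - x k‖ ^ 2 := by positivity
    have h2 : 0 ≤ lam * ‖y (k + 1) - y k‖ ^ 2 := by positivity
    simp only [hr]
    linarith
  have hbd : ∀ (z : ℕ → F) (a : F) (t : ℝ), 0 < t → (∀ k, t * ‖z k - a‖ ^ 2 ≤ e k) →
      ∀ k, ‖z k‖ ≤ √(t⁻¹ * e 0) + ‖a‖ := fun z a t ht hz k => by
    have h1 : ‖z k - a‖ ≤ √(t⁻¹ * e 0) :=
      Real.le_sqrt_of_sq_le ((le_inv_mul_iff₀ ht).2 ((hz k).trans (hanti k.zero_le)))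
    linarith [norm_le_norm_sub_add (z k) a]
  have hbx := hbd x xs lam⁻¹ (by positivity) fun k => by
    have h1 : 0 ≤ lam * ‖y k - ys‖ ^ 2 := by positivity
    have h2 : 0 ≤ (gam⁻¹ - c⁻¹) * ‖u k - us‖ ^ 2 := by positivity
    linarith [hlow k]
  have hby := hbd y ys lam hlam fun k => by
    have h1 : 0 ≤ lam⁻¹ * ‖x k - xs‖ ^ 2 := by positivity
    have h2 : 0 ≤ (gam⁻¹ - c⁻¹) * ‖u k - us‖ ^ 2 := by positivity
    linarith [hlow k]
  have hbu := hbd u us _ hcinv fun k => by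
    have h1 : 0 ≤ lam⁻¹ * ‖x k - xs‖ ^ 2 := by positivity
    have h2 : 0 ≤ lam * ‖y k - ys‖ ^ 2 := by positivity
    linarith [hlow k]
  refine ⟨⟨_, fun k => ⟨(hbx k).trans ((le_max_left _ _).trans (le_max_left _ _)),
    (hby k).trans ((le_max_right _ _).trans (le_max_left _ _)),
    (hbu k).trans (le_max_right _ _)⟩⟩, hdx, hdy, hdu, ⨅ k, e k, ?_⟩
  have hdx' : Tendsto (fun k => x k - x (k - 1)) atTop (𝓝 0) :=
    (tendsto_add_atTop_iff_nat 1).1 hdx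
  have h1 : Tendsto (fun k => 2 * ⟪u k - us, x k - x (k - 1)⟫_ℝ) atTop (𝓝 0) := by
    simpa using (tendsto_inner_of_bounded_of_tendsto_zero
      (fun k => (norm_sub_le (u k) us).trans (add_le_add_left (hbu k) _)) hdx').const_mul 2
  have h2 : Tendsto (fun k => c * ‖x k - x (k - 1)‖ ^ 2) atTop (𝓝 0) := by
    simpa using (hdx'.norm.pow 2).const_mul c
  have h3 := (hlim.sub h1).sub h2
  simp only [sub_zero] at h3
  refine h3.congr fun k => ?_
  simp only [he]
  ring

end Abstract

section Convergence

variable {F : Type*} [NormedAddCommGroup F] [InnerProductSpace ℝ F] [CompleteSpace F]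
  {V : Submodule ℝ F} [V.HasOrthogonalProjection] {C : Set F} {f H : F → ℝ}
  {lam gam β R : ℝ} {x y u : ℕ → F} {xs ys us : F}

theorem norm_gradient_le_of_lipschitz (hHL : ∀ x z, ‖∇ H x - ∇ H z‖ ≤ β⁻¹ * ‖x - z‖)
    (hβ : 0 < β) {z : F} (hz : ‖z‖ ≤ R) : ‖∇ H z‖ ≤ β⁻¹ * R + ‖∇ H 0‖ := by
  have h1 := hHL z 0
  rw [sub_zero] at h1
  have h2 := mul_le_mul_of_nonneg_left hz (inv_nonneg.2 hβ.le)
  linarith [norm_le_norm_sub_add (∇ H z) (∇ H 0)]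

/-- Weak limits of the iterates are primal-dual solutions. -/
theorem IsPrimalDualSeq.isPrimalDual_of_weakLim (hseq : IsPrimalDualSeq V C f H lam gam x y u)
    (hV : IsClosed (V : Set F)) (hCcl : IsClosed C) (hCcv : Convex ℝ C)
    (hf : ∀ z, (subdifferential f z).Nonempty) (hHcv : ConvexOn ℝ Set.univ H)
    (hHd : Differentiable ℝ H)
    {l : Filter ℕ} [l.NeBot] (hl : l ≤ atTop) {h : F} {R' : ℝ}
    (hR : ∀ k, ‖x k‖ ≤ R ∧ ‖y k‖ ≤ R ∧ ‖u k‖ ≤ R) (hR' : ∀ k, ‖∇ H (x k)‖ ≤ R')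
    (hdx : Tendsto (fun k => x (k + 1) - x k) atTop (𝓝 0))
    (hdy : Tendsto (fun k => y (k + 1) - y k) atTop (𝓝 0))
    (hdu : Tendsto (fun k => u (k + 1) - u k) atTop (𝓝 0))
    (hx : WeakLim x l xs) (hy : WeakLim y l ys) (hu : WeakLim u l us)
    (hh : WeakLim (fun k => ∇ H (x k)) l h) :
    IsPrimalDual V C f H xs ys us := by
  have hdx' : Tendsto (fun k => x k - x (k - 1)) atTop (𝓝 0) :=
    (tendsto_add_atTop_iff_nat 1).1 hdx
  have hdxn : Tendsto (fun k => x k - x (k + 1)) atTop (𝓝 0) := by simpa using hdx.neg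
  have hdyn : Tendsto (fun k => y k - y (k + 1)) atTop (𝓝 0) := by simpa using hdy.neg
  have hdun : Tendsto (fun k => u k - u (k + 1)) atTop (𝓝 0) := by simpa using hdu.neg
  have hx1 : WeakLim (fun k => x (k + 1)) l xs := hx.congr_sub (hdx.mono_left hl)
  have hy1 : WeakLim (fun k => y (k + 1)) l ys := hy.congr_sub (hdy.mono_left hl)
  have hu1 : WeakLim (fun k => u (k + 1)) l us := hu.congr_sub (hdu.mono_left hl)
  set w := fun k => x (k + 1) + lam • (y k - y (k + 1)) with hw
  set q := fun k => gam⁻¹ • (u k - u (k + 1)) + ((2 : ℝ) • x k - x (k - 1)) with hq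
  set g := fun k => lam⁻¹ • (x k - x (k + 1)) + y (k + 1)
    - V.starProjection (u (k + 1) + ∇ H (x k)) with hg
  have hxV : xs ∈ V := hx.mem_of_forall_mem hV V.convex hseq.mem
  have hyV : ys ∈ Vᗮ :=
    hy.mem_of_forall_mem V.isClosed_orthogonal Vᗮ.convex hseq.mem_orthogonal
  have hwx : WeakLim w l xs := hx1.congr_sub (by
    simpa [hw] using (hdyn.const_smul lam).mono_left hl)
  have hqd : Tendsto (fun k => q k - x k) atTop (𝓝 0) := by
    have := (hdun.const_smul gam⁻¹).add hdx'
    rw [smul_zero, add_zero] at this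
    refine this.congr fun k => ?_
    simp only [hq, two_smul]
    abel
  have hqx : WeakLim q l xs := hx.congr_sub (hqd.mono_left hl)
  have hxC : xs ∈ C := hqx.mem_of_forall_mem hCcl hCcv fun k => (hseq.mem_normalCone k).1
  have hgl : WeakLim g l (ys - V.starProjection (us + h)) := by
    refine WeakLim.sub (hy1.congr_sub ?_) (hu1.add hh).starProjection
    simpa using (hdxn.const_smul lam⁻¹).mono_left hl
  set B := fun k => ⟪g k, w k⟫_ℝ + ⟪u (k + 1), q k⟫_ℝ + ⟪∇ H (x k), x k⟫_ℝ with hB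
  have hBe : ∀ k, B k = lam⁻¹ * ⟪x (k + 1), x k - x (k + 1)⟫_ℝ
      + lam * ⟪y (k + 1), y k - y (k + 1)⟫_ℝ + ⟪u (k + 1), (q k - x k) + (x k - x (k + 1))⟫_ℝ
      + ⟪∇ H (x k), x k - x (k + 1)⟫_ℝ := fun k => by
    have := inner_add_sub_starProjection_add
        (V.smul_mem lam⁻¹ (V.sub_mem (hseq.mem k) (hseq.mem (k + 1))))
        (hseq.mem_orthogonal (k + 1)) (hseq.mem (k + 1))
        (Vᗮ.smul_mem lam (Vᗮ.sub_mem (hseq.mem_orthogonal k) (hseq.mem_orthogonal (k + 1))))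
        (u (k + 1) + ∇ H (x k))
    simp only [hB, hg, hw]
    rw [this, real_inner_smul_left, real_inner_smul_right, real_inner_comm (x (k + 1)),
      sub_add_sub_cancel, inner_sub_right (u (k + 1)), inner_sub_right (∇ H (x k)),
      inner_add_left]
    ring
  have hBl : Tendsto B atTop (𝓝 0) := by
    have t1 := (tendsto_inner_of_bounded_of_tendsto_zero (fun k => (hR (k + 1)).1) hdxn).const_mul
      lam⁻¹
    have t2 := (tendsto_inner_of_bounded_of_tendsto_zero (fun k => (hR (k + 1)).2.1)
      hdyn).const_mul lam
    have t3 := tendsto_inner_of_bounded_of_tendsto_zero (fun k => (hR (k + 1)).2.2)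
      (show Tendsto (fun k => (q k - x k) + (x k - x (k + 1))) atTop (𝓝 0) by
        simpa using hqd.add hdxn)
    have t4 := tendsto_inner_of_bounded_of_tendsto_zero hR' hdxn
    have := ((t1.add t2).add t3).add t4
    simp only [mul_zero, add_zero] at this
    exact this.congr fun k => (hBe k).symm
  have key : ∀ z, ∀ z₁ ∈ C, ∀ z₂, f xs + H xs + ⟪ys - V.starProjection (us + h), z⟫_ℝ
      + ⟪us, z₁⟫_ℝ + ⟪h, z₂⟫_ℝ ≤ f z + H z₂ := by
    intro z z₁ hz₁ z₂
    obtain ⟨g₀, hg₀⟩ := hf xs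
    have hlim := (((((hwx g₀).sub_const ⟪xs, g₀⟫_ℝ).const_add (f xs)).add
      (((hx (∇ H xs)).sub_const ⟪xs, ∇ H xs⟫_ℝ).const_add (H xs))).add
      (hgl z)).add (hu1 z₁) |>.add (hh z₂) |>.sub (hBl.mono_left hl)
    have hle := le_of_tendsto hlim (b := f z + H z₂) (Eventually.of_forall fun k => ?_)
    · linarith
    · have i1 := hseq.mem_subdifferential k z
      have i2 := (hseq.mem_normalCone k).2 z₁ hz₁
      have i3 := gradient_mem_subdifferential hHcv hHd (x k) z₂
      have i4 := hg₀ (w k)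
      have i5 := gradient_mem_subdifferential hHcv hHd xs (x k)
      change f (w k) + ⟪g k, z - w k⟫_ℝ ≤ f z at i1
      change ⟪u (k + 1), z₁ - q k⟫_ℝ ≤ 0 at i2
      rw [inner_sub_right] at i1 i2 i3
      rw [real_inner_comm, inner_sub_left] at i4 i5
      simp only [hB]
      linarith
  have horth : ⟪ys - V.starProjection (us + h), xs⟫_ℝ + ⟪us, xs⟫_ℝ + ⟪h, xs⟫_ℝ = 0 := by
    rw [inner_sub_left, V.inner_left_of_mem_orthogonal hxV hyV,
      V.inner_starProjection_left_eq_right, V.starProjection_eq_self_iff.2 hxV, inner_add_left]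
    ring
  have hhx : h = ∇ H xs := eq_gradient_of_mem_subdifferential hHd fun z => by
    have := key xs xs hxC z
    rw [inner_sub_right]
    linarith
  refine ⟨hxV, hyV, fun z => ?_, hxC, fun z hz => ?_⟩
  · have := key z xs hxC xs
    rw [← hhx, inner_sub_right]
    linarith
  · have := key xs z hz xs
    rw [inner_sub_right]
    linarith

/-- Weak convergence of the primal iterates to a primal-dual solution. -/
theorem IsPrimalDualSeq.exists_weakLim (hseq : IsPrimalDualSeq V C f H lam gam x y u)
    (hs : ∃ x y u, IsPrimalDual V C f H x y u)
    (hV : IsClosed (V : Set F)) (hCcl : IsClosed C) (hCcv : Convex ℝ C)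
    (hf : ∀ z, (subdifferential f z).Nonempty) (hHcv : ConvexOn ℝ Set.univ H)
    (hHd : Differentiable ℝ H) (hβ : 0 < β) (hHL : ∀ x z, ‖∇ H x - ∇ H z‖ ≤ β⁻¹ * ‖x - z‖)
    (hlam : 0 < lam) (hgam : 0 < gam) (hgam' : gam < 1 / lam - 1 / (2 * β)) :
    ∃ xs ys us, IsPrimalDual V C f H xs ys us ∧ WeakLim x atTop xs := by
  have hT := fun {xs ys us : F} (hs : IsPrimalDual V C f H xs ys us) =>
    hseq.tendsto hs hHcv hHd hβ hHL hlam hgam hgam'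
  obtain ⟨_, _, _, hs⟩ := hs
  obtain ⟨⟨R, hR⟩, hdx, hdy, hdu, -⟩ := hT hs
  have hR' := fun k => norm_gradient_le_of_lipschitz hHL hβ (hR k).1
  have hlim : ∀ l : Ultrafilter ℕ, (l : Filter ℕ) ≤ atTop → ∃ xs ys us,
      IsPrimalDual V C f H xs ys us ∧ WeakLim x l xs ∧ WeakLim y l ys ∧ WeakLim u l us := by
    intro l hl
    obtain ⟨xs, hx⟩ := DRO.exists_weakLim l fun k => (hR k).1
    obtain ⟨ys, hy⟩ := DRO.exists_weakLim l fun k => (hR k).2.1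
    obtain ⟨us, hu⟩ := DRO.exists_weakLim l fun k => (hR k).2.2
    obtain ⟨h, hh⟩ := DRO.exists_weakLim l hR'
    exact ⟨xs, ys, us, hseq.isPrimalDual_of_weakLim hV hCcl hCcv hf hHcv hHd hl hR hR' hdx hdy hdu
      hx hy hu hh, hx, hy, hu⟩
  obtain ⟨xs, ys, us, hpd, hx, hy, hu⟩ := hlim (Ultrafilter.of atTop) (Ultrafilter.of_le atTop)
  refine ⟨xs, ys, us, hpd, fun v => (tendsto_iff_ultrafilter _ _ _).2 fun l hl => ?_⟩
  obtain ⟨xs', ys', us', hpd', hx', hy', hu'⟩ := hlim l hl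
  obtain ⟨-, -, -, -, L, hL⟩ := hT hpd
  obtain ⟨-, -, -, -, L', hL'⟩ := hT hpd'
  have h1 := tendsto_nhds_unique (tendsto_dist₃_sub hx hy hu xs ys us xs' ys' us')
    ((hL.sub hL').mono_left (Ultrafilter.of_le atTop))
  have h2 := tendsto_nhds_unique (tendsto_dist₃_sub hx' hy' hu' xs ys us xs' ys' us')
    ((hL.sub hL').mono_left hl)
  have h3 : xs' = xs := by
    rw [← h2] at h1
    simp only [dist₃, sub_self, norm_zero, norm_sub_rev xs', norm_sub_rev ys',
      norm_sub_rev us'] at h1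
    have p2 : 0 ≤ lam * ‖ys - ys'‖ ^ 2 := by positivity
    have p3 : 0 ≤ gam⁻¹ * ‖us - us'‖ ^ 2 := by positivity
    have p1 : lam⁻¹ * ‖xs - xs'‖ ^ 2 ≤ 0 := by linarith
    have p0 : ‖xs - xs'‖ ^ 2 ≤ 0 := by
      by_contra! hcon
      exact absurd p1 (not_le.2 (by positivity))
    exact (sub_eq_zero.1 (norm_eq_zero.1
      (pow_eq_zero_iff two_ne_zero |>.1 (le_antisymm p0 (sq_nonneg _))))).symm
  exact h3 ▸ hx' v

end Convergence

section Optimality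

variable {F : Type*} [NormedAddCommGroup F] [InnerProductSpace ℝ F] [CompleteSpace F]
  {V : Submodule ℝ F} [V.HasOrthogonalProjection] {C : Set F} {f H : F → ℝ} {xs ys us : F}

theorem IsPrimalDual.isMinOn (hs : IsPrimalDual V C f H xs ys us)
    (hHcv : ConvexOn ℝ Set.univ H) (hHd : Differentiable ℝ H) :
    IsMinOn (fun z => H z + f z) ((V : Set F) ∩ C) xs := by
  refine isMinOn_iff.2 fun z hz => ?_
  have h1 := hs.mem_subdifferential z
  have h2 := hs.mem_normalCone.2 z hz.2
  have h3 := gradient_mem_subdifferential hHcv hHd xs z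
  have h4 := inner_add_sub_starProjection_add V.zero_mem hs.mem_orthogonal
    (V.sub_mem hz.1 hs.mem) Vᗮ.zero_mem (us + ∇ H xs)
  rw [zero_add, add_zero, inner_zero_left, inner_zero_right, inner_add_left] at h4
  linarith

theorem mem_orthogonal_of_mem_normalCone {F : Type*} [NormedAddCommGroup F]
    [InnerProductSpace ℝ F] {V : Submodule ℝ F} {xs v : F} (hv : v ∈ normalCone (V : Set F) xs) :
    v ∈ Vᗮ := by
  refine (V.mem_orthogonal' v).2 fun z hz => ?_
  have h1 := hv.2 _ (V.add_mem hv.1 hz)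
  have h2 := hv.2 _ (V.sub_mem hv.1 hz)
  simp only [add_sub_cancel_left, sub_sub_cancel_left, inner_neg_right] at h1 h2
  linarith

theorem isPrimalDual_of_add_eq_zero {g v : F} (hg : g ∈ subdifferential f xs) (hu : us ∈ normalCone C xs)
    (hv : v ∈ normalCone (V : Set F) xs) (h : g + us + ∇ H xs + v = 0) :
    IsPrimalDual V C f H xs (g + V.starProjection (us + ∇ H xs)) us := by
  refine ⟨hv.1, ?_, by rwa [add_sub_cancel_right], hu⟩
  have e : g + V.starProjection (us + ∇ H xs)
      = -v - ((us + ∇ H xs) - V.starProjection (us + ∇ H xs)) := by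
    rw [neg_eq_of_add_eq_zero_left h]
    abel
  rw [e]
  exact Vᗮ.sub_mem (Vᗮ.neg_mem (mem_orthogonal_of_mem_normalCone hv))
    (V.sub_starProjection_mem_orthogonal _)

end Optimality

section SupFun

variable {N : ℕ} {P : Set (Fin N → ℝ)}

theorem abs_sum_mul_le_of_mem_stdSimplex (hP : P ⊆ stdSimplex ℝ (Fin N)) {p : Fin N → ℝ}
    (hp : p ∈ P) (c : Fin N → ℝ) : |∑ i, p i * c i| ≤ ∑ i, |c i| := by
  refine (Finset.abs_sum_le_sum_abs _ _).trans (Finset.sum_le_sum fun i _ => ?_)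
  rw [abs_mul, abs_of_nonneg ((hP hp).1 i)]
  refine mul_le_of_le_one_left (abs_nonneg _) ?_
  rw [← (hP hp).2]
  exact Finset.single_le_sum (fun j _ => (hP hp).1 j) (Finset.mem_univ i)

theorem sum_mul_le_of_isMinOn (hPcv : Convex ℝ P) {α b p q : Fin N → ℝ} (hp : p ∈ P)
    (hmin : IsMinOn (fun p : Fin N → ℝ => (1 / 2) * ∑ i, p i ^ 2 * α i - ∑ i, p i * b i) P p)
    (hq : q ∈ P) :
    ∑ i, q i * (b i - p i * α i) ≤ ∑ i, p i * (b i - p i * α i) := by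
  set A := ∑ i, (q i - p i) ^ 2 * α i
  set D := ∑ i, (q i - p i) * (b i - p i * α i) with hD
  have hDe : D = ∑ i, q i * (b i - p i * α i) - ∑ i, p i * (b i - p i * α i) := by
    simp only [hD, sub_mul, Finset.sum_sub_distrib]
  have h : ∀ t ∈ Set.Ioc (0 : ℝ) 1, D ≤ t * (A / 2) := fun t ht => by
    have hm := isMinOn_iff.1 hmin _
      (hPcv.add_smul_sub_mem hp hq ⟨ht.1.le, ht.2⟩)
    have e1 : ∑ i, (p + t • (q - p)) i ^ 2 * α i
        = ∑ i, p i ^ 2 * α i + 2 * t * ∑ i, (q i - p i) * (p i * α i) + t ^ 2 * A := by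
      simp only [A, Finset.mul_sum, ← Finset.sum_add_distrib]
      refine Finset.sum_congr rfl fun i _ => ?_
      simp only [Pi.add_apply, Pi.smul_apply, Pi.sub_apply, smul_eq_mul]
      ring
    have e2 : ∑ i, (p + t • (q - p)) i * b i
        = ∑ i, p i * b i + t * ∑ i, (q i - p i) * b i := by
      simp only [Finset.mul_sum, ← Finset.sum_add_distrib]
      refine Finset.sum_congr rfl fun i _ => ?_
      simp only [Pi.add_apply, Pi.smul_apply, Pi.sub_apply, smul_eq_mul]
      ring
    have e3 : D = ∑ i, (q i - p i) * b i - ∑ i, (q i - p i) * (p i * α i) := by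
      simp only [hD, mul_sub, Finset.sum_sub_distrib]
    rw [e1, e2] at hm
    refine le_of_mul_le_mul_left ?_ ht.1
    rw [e3]
    linarith
  have h0 : D ≤ 0 := by
    refine ge_of_tendsto (x := 𝓝[>] (0 : ℝ)) (f := fun t => t * (A / 2)) ?_
      (Filter.mem_of_superset (Ioc_mem_nhdsGT one_pos) h)
    have : Tendsto (fun t : ℝ => t * (A / 2)) (𝓝 0) (𝓝 (0 * (A / 2))) :=
      tendsto_id.mul_const _
    rw [zero_mul] at this
    exact this.mono_left nhdsWithin_le_nhds
  linarith

variable {E : Type*} [NormedAddCommGroup E] [InnerProductSpace ℝ E] {a : Fin N → E}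
  {ξ : Fin N → ℝ}

theorem le_supFun (hP : P ⊆ stdSimplex ℝ (Fin N)) {p : Fin N → ℝ} (hp : p ∈ P) (x : Pow E N) :
    ∑ i, p i * (⟪a i, x i⟫_ℝ + ξ i) ≤ supFun P a ξ x :=
  le_ciSup (f := fun p : P => ∑ i, (p : Fin N → ℝ) i * (⟪a i, x i⟫_ℝ + ξ i))
    ⟨_, Set.forall_mem_range.2 fun q : P =>
      (le_abs_self _).trans (abs_sum_mul_le_of_mem_stdSimplex hP q.2 _)⟩ ⟨p, hp⟩

theorem mem_subdifferential_supFun (hP : P ⊆ stdSimplex ℝ (Fin N)) {p : Fin N → ℝ} (hp : p ∈ P)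
    {x : Pow E N} (hmax : ∀ q ∈ P,
      ∑ i, q i * (⟪a i, x i⟫_ℝ + ξ i) ≤ ∑ i, p i * (⟪a i, x i⟫_ℝ + ξ i))
    {g : Pow E N} (hg : ∀ i, g i = p i • a i) : g ∈ subdifferential (supFun P a ξ) x := by
  intro z
  have : Nonempty P := ⟨⟨p, hp⟩⟩
  have h1 : supFun P a ξ x ≤ ∑ i, p i * (⟪a i, x i⟫_ℝ + ξ i) := ciSup_le fun q => hmax q q.2
  have h2 := le_supFun (a := a) (ξ := ξ) hP hp z
  have h3 : ⟪g, z - x⟫_ℝ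
      = ∑ i, p i * (⟪a i, z i⟫_ℝ + ξ i) - ∑ i, p i * (⟪a i, x i⟫_ℝ + ξ i) := by
    rw [PiLp.inner_apply, ← Finset.sum_sub_distrib]
    refine Finset.sum_congr rfl fun i _ => ?_
    rw [hg, real_inner_smul_left, PiLp.sub_apply, inner_sub_right]
    ring
  linarith

theorem subdifferential_supFun_nonempty (hPne : P.Nonempty) (hPcl : IsClosed P)
    (hP : P ⊆ stdSimplex ℝ (Fin N)) (x : Pow E N) :
    (subdifferential (supFun P a ξ) x).Nonempty := by
  obtain ⟨p, hp, hmax⟩ := ((isCompact_stdSimplex ℝ (Fin N)).of_isClosed_subset hPcl hP).exists_isMaxOn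
    (f := fun p : Fin N → ℝ => ∑ i, p i * (⟪a i, x i⟫_ℝ + ξ i)) hPne (by fun_prop)
  exact ⟨WithLp.toLp 2 fun i => p i • a i,
    mem_subdifferential_supFun hP hp (fun q hq => hmax hq) fun i => rfl⟩

end SupFun

section Box

variable {E : Type*} [NormedAddCommGroup E] [InnerProductSpace ℝ E] {N : ℕ} {Q : Fin N → Set E}

theorem isClosed_box {E : Type*} [NormedAddCommGroup E] {Q : Fin N → Set E}
    (hQ : ∀ i, IsClosed (Q i)) : IsClosed (box Q) := by
  have h : box Q = ⋂ i, (fun x : Pow E N => x i) ⁻¹' Q i := by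
    ext x
    simp [box]
  rw [h]
  exact isClosed_iInter fun i => (hQ i).preimage (by fun_prop)

theorem convex_box (hQ : ∀ i, Convex ℝ (Q i)) : Convex ℝ (box Q) :=
  fun _ hx _ hy _ _ hs ht hst i => hQ i (hx i) (hy i) hs ht hst

theorem mem_normalCone_box {x u : Pow E N} (h : ∀ i, u i ∈ normalCone (Q i) (x i)) :
    u ∈ normalCone (box Q) x :=
  ⟨fun i => (h i).1, fun z hz => by
    rw [PiLp.inner_apply]
    exact Finset.sum_nonpos fun i _ => (h i).2 _ (hz i)⟩

theorem smul_sub_proj_mem_normalCone [CompleteSpace E] {S : Set E} (hne : S.Nonempty)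
    (hcl : IsClosed S) (hcv : Convex ℝ S) {c : ℝ} (hc : 0 ≤ c) (x : E) :
    c • (x - proj S x) ∈ normalCone S (proj S x) :=
  ⟨(proj_spec hne hcl hcv x).1, fun z hz => by
    rw [real_inner_smul_left]
    exact mul_nonpos_of_nonneg_of_nonpos hc (inner_sub_proj_le_zero hne hcl hcv x hz)⟩

end Box

section Generated

variable {E : Type*} [NormedAddCommGroup E] [InnerProductSpace ℝ E] [CompleteSpace E] {N : ℕ}
  {V : Submodule ℝ (Pow E N)} {Q : Fin N → Set E} {P : Set (Fin N → ℝ)} {H : Pow E N → ℝ}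
  {a : Fin N → E} {ξ : Fin N → ℝ} {lam gam : ℝ} {x xbar y zbar u w : ℕ → Pow E N}
  {p : ℕ → Fin N → ℝ}

theorem IsGenerated.isPrimalDualSeq [V.HasOrthogonalProjection]
    (hgen : IsGenerated V Q P H a ξ lam gam x xbar y zbar u w p)
    (hV : IsClosed (V : Set (Pow E N))) (hQne : ∀ i, (Q i).Nonempty) (hQcl : ∀ i, IsClosed (Q i))
    (hQcv : ∀ i, Convex ℝ (Q i)) (hPne : P.Nonempty) (hPcl : IsClosed P) (hPcv : Convex ℝ P)
    (hP : P ⊆ stdSimplex ℝ (Fin N)) (hlam : 0 < lam) (hgam : 0 < gam) :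
    IsPrimalDualSeq V (box Q) (supFun P a ξ) H lam gam x y u := by
  have hxbar : ∀ k, xbar k = (2 : ℝ) • x k - x (k - 1)
    | 0 => by rw [hgen.xbar_zero, two_smul]; simp
    | k + 1 => hgen.xbar_succ k
  have hxs : ∀ k, x (k + 1) = V.starProjection (w (k + 1)) := fun k => by
    rw [hgen.x_succ, proj_submodule V hV]
  have hws : ∀ k, x (k + 1) + lam • (y k - y (k + 1)) = w (k + 1) := fun k => by
    rw [hgen.y_succ k, sub_add_cancel_left, smul_neg, smul_inv_smul₀ hlam.ne']
    abel
  refine ⟨?_, ?_, fun k => ?_, fun k => ?_⟩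
  · rintro (_ | k)
    · exact hgen.x_zero
    · rw [hxs]
      exact V.starProjection_apply_mem _
  · intro k
    induction k with
    | zero => exact hgen.y_zero
    | succ k ih =>
      rw [hgen.y_succ, hxs, ← neg_sub (w (k + 1))]
      exact Vᗮ.add_mem ih (Vᗮ.smul_mem _ (Vᗮ.neg_mem (V.sub_starProjection_mem_orthogonal _)))
  · rw [hws]
    obtain ⟨hp, hmin⟩ := rho_spec hPne hPcl hP (fun i => lam * ‖a i‖ ^ 2)
      (fun i => ⟪a i, zbar k i⟫_ℝ + ξ i)
    rw [← hgen.p_eq] at hp hmin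
    have hw : ∀ i, ⟪a i, w (k + 1) i⟫_ℝ + ξ i
        = ⟪a i, zbar k i⟫_ℝ + ξ i - p k i * (lam * ‖a i‖ ^ 2) := fun i => by
      rw [hgen.w_succ, inner_sub_right, real_inner_smul_right, real_inner_self_eq_norm_sq]
      ring
    refine mem_subdifferential_supFun hP hp (fun q hq => ?_) fun i => ?_
    · simp only [hw]
      exact sum_mul_le_of_isMinOn hPcv hp hmin hq
    · have e : lam⁻¹ • (x k - x (k + 1)) + y (k + 1) - V.starProjection (u (k + 1) + ∇ H (x k))
          = lam⁻¹ • (zbar k - w (k + 1)) := by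
        rw [hgen.zbar_eq, proj_submodule V hV, hgen.y_succ]
        simp only [smul_sub, smul_add, inv_smul_smul₀ hlam.ne']
        abel
      rw [e, PiLp.smul_apply, PiLp.sub_apply, hgen.w_succ, sub_sub_cancel, mul_smul,
        inv_smul_smul₀ hlam.ne']
  · rw [← hxbar]
    refine mem_normalCone_box fun i => ?_
    set q := proj (Q i) (gam⁻¹ • u k i + xbar k i) with hq
    have e1 : u (k + 1) i = gam • (gam⁻¹ • u k i + xbar k i - q) := by
      rw [hgen.u_succ, smul_sub, smul_add, smul_inv_smul₀ hgam.ne']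
    have e2 : (gam⁻¹ • (u k - u (k + 1)) + xbar k) i = q := by
      rw [PiLp.add_apply, PiLp.smul_apply, PiLp.sub_apply, smul_sub, e1, inv_smul_smul₀ hgam.ne']
      abel
    rw [e2, e1, hq]
    exact smul_sub_proj_mem_normalCone (hQne i) (hQcl i) (hQcv i) hgam.le _

end Generated

end DRO

theorem mainTheorem4 {E : Type*} [NormedAddCommGroup E] [InnerProductSpace ℝ E] [CompleteSpace E]
    {N : ℕ}
    (V : Submodule ℝ (DRO.Pow E N)) (hV : IsClosed (V : Set (DRO.Pow E N)))
    (Q : Fin N → Set E) (hQne : ∀ i, (Q i).Nonempty) (hQcl : ∀ i, IsClosed (Q i))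
    (hQcv : ∀ i, Convex ℝ (Q i))
    (P : Set (Fin N → ℝ)) (hPne : P.Nonempty) (hPcl : IsClosed P) (hPcv : Convex ℝ P)
    (hP : P ⊆ stdSimplex ℝ (Fin N))
    (a : Fin N → E) (ha : ∀ i, a i ≠ 0) (ξ : Fin N → ℝ)
    (H : DRO.Pow E N → ℝ) (hHcv : ConvexOn ℝ Set.univ H) (hHd : Differentiable ℝ H)
    (β : ℝ) (hβ : 0 < β) (hHL : ∀ x z, ‖∇ H x - ∇ H z‖ ≤ β⁻¹ * ‖x - z‖)
    (hKKT : ∃ x, DRO.IsKKTPoint V Q P H a ξ x)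
    (lam gam : ℝ) (hlam : 0 < lam) (hlam' : lam < 2 * β)
    (hgam : 0 < gam) (hgam' : gam < 1 / lam - 1 / (2 * β))
    (x xbar y zbar u w : ℕ → DRO.Pow E N) (p : ℕ → Fin N → ℝ)
    (hgen : DRO.IsGenerated V Q P H a ξ lam gam x xbar y zbar u w p) :
    ∃ xsol : DRO.Pow E N, DRO.IsSolution V Q P H a ξ xsol ∧
      Tendsto (fun k => toWeakSpace ℝ (DRO.Pow E N) (x k)) atTop
        (𝓝 (toWeakSpace ℝ (DRO.Pow E N) xsol)) := by
  have : CompleteSpace V := hV.completeSpace_coe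
  have hseq := hgen.isPrimalDualSeq hV hQne hQcl hQcv hPne hPcl hPcv hP hlam hgam
  obtain ⟨xk, g, hg, us, hu, v, hv, h0⟩ := hKKT
  obtain ⟨xs, ys, us, hs, hx⟩ := hseq.exists_weakLim
    ⟨_, _, _, DRO.isPrimalDual_of_add_eq_zero hg hu hv h0⟩ hV (DRO.isClosed_box hQcl)
    (DRO.convex_box hQcv) (DRO.subdifferential_supFun_nonempty hPne hPcl hP) hHcv hHd hβ hHL
    hlam hgam hgam'
  exact ⟨xs, ⟨⟨hs.mem, hs.mem_normalCone.1⟩, hs.isMinOn hHcv hHd⟩, hx.tendsto_toWeakSpace⟩
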